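/- Let $G$ be a finite-dimensional real Lie group with Lie algebra $\mathcal G$ and let $\sigma$ be an involutive automorphism of $G$ whose differential (also written $\sigma$) is a Cartan involution of $\mathcal G$, i.e. $(X,\sigma X)<0$ for all $X\neq 0$, where $(\cdot,\cdot)$ is the Killing form (so $G$ is semisimple and $G/H$ is a symmetric space of noncompact type). Let $H$ be the subgroup of fixed points of $\sigma$, and $\mathcal G=\mathcal H\oplus\mathcal K$ the decomposition into the eigenspaces of $\sigma$ for $+1$ and $-1$. Let $\mathcal A$ be a maximal commuting subspace of $\mathcal K$, and $\mathcal B\subset\mathcal H$ a subspace such that $\mathcal A\oplus\mathcal B$ is a maximal commutative subalgebra of $\mathcal G$. Let $\mu\in\mathcal H^*$, $\chi(X,Y)=\mu([X,Y])$ for $X,Y\in\mathcal H$, $H_\mu\subset H$ the isotropy group of $\mu$ for the coadjoint action, and $\mathcal H_\mu=\{X\in\mathcal H:\chi(X,\cdot)=0\}$. Assume $\mathcal H=\mathcal H_\mu\oplus\mathcal B\oplus\mathcal C$, where $\mathcal B$ and $\mathcal C$ are maximal isotropic subspaces (in $\mathcal H/\mathcal H_\mu$) for $\chi$. Let $\hat\mu:\mathcal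 H/\mathcal H_\mu\to\mathcal H^*$ be given by $\hat\mu(Y)(X)=\chi(X,Y)$. On $T^*G\simeq G\times\mathcal G^*$ consider the moment maps $\mathcal P^L(g,\xi)=(X\mapsto\xi(g^{-1}Xg))|_{\mathcal H}$ and $\mathcal P^R(g,\xi)=-\xi|_{\mathcal H}$, and $N_\mu=\{\mathcal P^L=\mu,\ \mathcal P^R=0\}$. Let $(Q,L)\in N_\mu$ with $Q=\exp q$, where $q\in\mathcal A$ is regular ($\alpha(q)\ne0$ for every restricted root $\alpha$). Let $h_2$ be a $G$-valued function, defined near $Q$ and smooth at $Q$, such that $h_2(g)\in H$ and $g\in H\exp(\mathcal A)\,h_2(g)$ for all $g$ near $Q$, and such that $h_2(h\exp(x)k)=k$ for all $h\in H_\mu$, $x\in\mathcal A$, $k\in H$ with $(h,x,k)$ close to $(1,q,1)$. Put $$\nabla_g h_2(X)=\tfrac{d}{dt}h_2(Q\exp(tX))\big|_{t=0}\quad(X\in\mathcal G),\qquad D_Q(X)=\nabla_g h_2(Q^{-1}XQ)\quad(X\in\mathcal H),$$ and, for $Z\in\mathcal K$, let $\lambda_Z\in\mathcal H^*$ be $\lambda_Z(X)=\langle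 L,[Z,D_Q(X)]\rangle$. Suppose that $h_2$ is chosen so that $D_Q(X)=0$ for all $X\in\mathcal C$. Then: 1. For every $Z\in\mathcal K$ the equation $\hat\mu(V)=\lambda_Z$, i.e. $\langle\mu,[X,V]\rangle=\langle L,[Z,D_Q(X)]\rangle$ for all $X\in\mathcal H$, has exactly one solution $V=V_Z\in\mathcal H/\mathcal H_\mu$, it depends linearly on $Z$, it lies in (the image of) $\mathcal C$, and $D_Q(V_Z)=0$ (for every representative of $V_Z$ in $\mathcal H$). 2. The $R$-matrix, i.e. the linear map $R:\mathcal K\to\mathcal H$ given by $R(Z)=\nabla_g h_2(Z)+\tfrac12 D_Q(V_Z)$, is well defined, and $R(Z)=\nabla_g h_2(Z)$ for all $Z\in\mathcal K$. -/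

import Mathlib

open scoped Manifold ContDiff Topology
open VectorField

namespace Calogero

noncomputable section

/-! ## Lie-group preliminaries

`G` is a finite-dimensional real smooth Lie group. Its Lie algebra is Mathlib's
`GroupLieAlgebra (𝓡 n) G`, the tangent space at the identity. -/

instance : ENat.LEInfty (minSmoothness ℝ 3) := ⟨by
  rw [minSmoothness_of_isRCLikeNormedField]
  exact ENat.LEInfty.out⟩

variable {n : ℕ} {G : Type*} [TopologicalSpace G] [ChartedSpace (EuclideanSpace ℝ (Fin n)) G]
  [Group G]

/-- The derivative at the identity of a group endomorphism `φ` (recall `φ 1 = 1`), as an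
endomorphism of the Lie algebra. -/
def lieMap (φ : G →* G) : GroupLieAlgebra (𝓡 n) G →L[ℝ] GroupLieAlgebra (𝓡 n) G :=
  mfderiv (𝓡 n) (𝓡 n) φ 1

/-- The adjoint action `X ↦ g X g⁻¹` of `G` on its Lie algebra. -/
def Ad (g : G) : GroupLieAlgebra (𝓡 n) G →L[ℝ] GroupLieAlgebra (𝓡 n) G :=
  lieMap (MulAut.conj g).toMonoidHom

/-- `g = exp X`: there is a smooth one-parameter subgroup with initial velocity `X` which takes
the value `g` at time `1`. -/
def IsExp (X : GroupLieAlgebra (𝓡 n) G) (g : G) : Prop :=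
  ∃ γ : ℝ → G, ContMDiff 𝓘(ℝ, ℝ) (𝓡 n) ∞ γ ∧ (∀ s t, γ (s + t) = γ s * γ t) ∧
    (mfderiv 𝓘(ℝ, ℝ) (𝓡 n) γ 0 (1 : ℝ) : EuclideanSpace ℝ (Fin n)) = X ∧ γ 1 = g

/-- For a `G`-valued function `h₂` near `Q` with `h₂ Q = 1`, the derivative
`X ↦ d/dt h₂ (Q exp (t X)) |_{t = 0}`, with values in the tangent space at `h₂ Q = 1`. -/
def nabla (h₂ : G → G) (Q : G) : GroupLieAlgebra (𝓡 n) G →L[ℝ] GroupLieAlgebra (𝓡 n) G :=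
  mfderiv (𝓡 n) (𝓡 n) (fun x => h₂ (Q * x)) 1

theorem lieMap_comp (φ ψ : G →* G) (hφ : ContMDiff (𝓡 n) (𝓡 n) ∞ φ)
    (hψ : ContMDiff (𝓡 n) (𝓡 n) ∞ ψ) (X : GroupLieAlgebra (𝓡 n) G) :
    lieMap (φ.comp ψ) X = lieMap φ (lieMap ψ X) := by
  have h := mfderiv_comp (I := 𝓡 n) (I' := 𝓡 n) (I'' := 𝓡 n) (f := ψ) (g := φ) (1 : G)
    ((hφ _).mdifferentiableAt (by simp)) ((hψ _).mdifferentiableAt (by simp))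
  have h1 : ψ 1 = 1 := map_one ψ
  unfold lieMap
  rw [MonoidHom.coe_comp, h, h1]
  rfl

theorem lieMap_invol {σ : G →* G} (hσ : ContMDiff (𝓡 n) (𝓡 n) ∞ σ)
    (hσσ : ∀ g, σ (σ g) = g) (v : GroupLieAlgebra (𝓡 n) G) : lieMap σ (lieMap σ v) = v := by
  rw [← lieMap_comp σ σ hσ hσ]
  have : σ.comp σ = MonoidHom.id G := by ext g; exact hσσ g
  rw [this]
  unfold lieMap
  erw [mfderiv_id]
  rfl

variable [LieGroup (𝓡 n) ∞ G]

theorem contMDiff_conj (g : G) :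
    ContMDiff (𝓡 n) (𝓡 n) ∞ (MulAut.conj g).toMonoidHom := by
  have h1 : ContMDiff (𝓡 n) (𝓡 n) ∞ (fun x : G => g * x) := contMDiff_mul_left
  have h2 : ContMDiff (𝓡 n) (𝓡 n) ∞ (fun x : G => x * g⁻¹) := contMDiff_mul_right
  exact h2.comp h1

theorem mpullback_lieMap {σ : G →* G} (hσ : ContMDiff (𝓡 n) (𝓡 n) ∞ σ)
    (hσσ : ∀ g, σ (σ g) = g) (v : GroupLieAlgebra (𝓡 n) G) :
    mpullback (𝓡 n) (𝓡 n) σ (mulInvariantVectorField (lieMap σ v)) =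
      mulInvariantVectorField v := by
  have hd : ∀ g, MDifferentiableAt (𝓡 n) (𝓡 n) σ g := fun g => (hσ g).mdifferentiableAt (by simp)
  have hm : ∀ a b : G, MDifferentiableAt (𝓡 n) (𝓡 n) (fun x : G => a * x) b := fun a b =>
    (contMDiff_mul_left (I := 𝓡 n) (n := ∞) (a := a) b).mdifferentiableAt (by simp)
  ext g
  have key : mulInvariantVectorField (lieMap σ v) (σ g) =
      mfderiv (𝓡 n) (𝓡 n) σ g (mulInvariantVectorField v g) := by
    have e : (fun x : G => σ g * x) ∘ σ = σ ∘ (fun x : G => g * x) := by ext x; simp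
    have h1 := mfderiv_comp (I := 𝓡 n) (I' := 𝓡 n) (I'' := 𝓡 n) (1 : G) (hm (σ g) (σ 1)) (hd 1)
    have h2 := mfderiv_comp (I := 𝓡 n) (I' := 𝓡 n) (I'' := 𝓡 n) (1 : G) (hd (g * 1)) (hm g 1)
    rw [e, h2] at h1
    have h3 := congrArg (fun T => T v) h1
    have h4 : σ 1 = 1 := map_one σ
    rw [h4] at h3
    have h5 : g * 1 = g := mul_one g
    have h6 : σ g * 1 = σ g := mul_one _
    rw [h5] at h3
    exact h3.symm
  have inv : (mfderiv (𝓡 n) (𝓡 n) σ g).inverse = mfderiv (𝓡 n) (𝓡 n) σ (σ g) := by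
    have e : (σ : G → G) ∘ σ = id := by ext x; exact hσσ x
    have h1 := mfderiv_comp (I := 𝓡 n) (I' := 𝓡 n) (I'' := 𝓡 n) g (hd (σ g)) (hd g)
    have h2 := mfderiv_comp (I := 𝓡 n) (I' := 𝓡 n) (I'' := 𝓡 n) (σ g) (hd (σ (σ g))) (hd (σ g))
    rw [e, mfderiv_id] at h1 h2
    rw [hσσ g] at h2
    exact ContinuousLinearMap.inverse_eq h2.symm h1.symm
  rw [mpullback_apply, key, inv]
  have e : (σ : G → G) ∘ σ = id := by ext x; exact hσσ x
  have h1 := mfderiv_comp (I := 𝓡 n) (I' := 𝓡 n) (I'' := 𝓡 n) g (hd (σ g)) (hd g)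
  rw [e, mfderiv_id] at h1
  exact (congrArg (fun T => T (mulInvariantVectorField v g)) h1).symm

theorem lieMap_bracket {σ : G →* G} (hσ : ContMDiff (𝓡 n) (𝓡 n) ∞ σ)
    (hσσ : ∀ g, σ (σ g) = g) (v w : GroupLieAlgebra (𝓡 n) G) :
    lieMap σ ⁅v, w⁆ = ⁅lieMap σ v, lieMap σ w⁆ := by
  have h := mpullback_mlieBracket (I := 𝓡 n) (I' := 𝓡 n) (n := ∞) (f := σ) (x₀ := (1 : G))
    (V := mulInvariantVectorField (lieMap σ v)) (W := mulInvariantVectorField (lieMap σ w))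
    (mdifferentiableAt_mulInvariantVectorField _) (mdifferentiableAt_mulInvariantVectorField _)
    (hσ 1) (by
      rw [minSmoothness_of_isRCLikeNormedField]
      exact ENat.LEInfty.out)
  rw [mpullback_lieMap hσ hσσ, mpullback_lieMap hσ hσσ, mpullback_apply] at h
  have h1 : σ 1 = 1 := map_one σ
  rw [h1, ← GroupLieAlgebra.bracket_def, ← GroupLieAlgebra.bracket_def] at h
  have h2 : (lieMap σ).inverse ⁅lieMap σ v, lieMap σ w⁆ = ⁅v, w⁆ := h
  have inv : (lieMap σ : GroupLieAlgebra (𝓡 n) G →L[ℝ] GroupLieAlgebra (𝓡 n) G).inverse =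
      lieMap σ :=
    ContinuousLinearMap.inverse_eq (ContinuousLinearMap.ext fun x => lieMap_invol hσ hσσ x)
      (ContinuousLinearMap.ext fun x => lieMap_invol hσ hσσ x)
  rw [inv] at h2
  rw [← h2, lieMap_invol hσ hσσ]
/-! ## The symmetric pair -/

variable (n G) in
/-- A smooth involutive automorphism of `G`. -/
structure SmoothInvolution where
  hom : G →* G
  smooth : ContMDiff (𝓡 n) (𝓡 n) ∞ hom
  invol : ∀ g, hom (hom g) = g

namespace SmoothInvolution

variable (σ : SmoothInvolution n G)

/-- `H`, the subgroup of fixed points of `σ`. -/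
def H : Subgroup G where
  carrier := {g | σ.hom g = g}
  mul_mem' {a b} ha hb := by
    simp only [Set.mem_ofPred_eq] at ha hb ⊢
    rw [map_mul, ha, hb]
  one_mem' := map_one _
  inv_mem' {a} ha := by
    simp only [Set.mem_ofPred_eq] at ha ⊢
    rw [map_inv, ha]

/-- `𝓗`, the eigenspace of `σ` for `+1`; it is the Lie algebra of `H`. -/
def 𝓗 : LieSubalgebra ℝ (GroupLieAlgebra (𝓡 n) G) where
  carrier := {X | lieMap σ.hom X = X}
  add_mem' {a b} ha hb := by
    simp only [Set.mem_ofPred_eq] at ha hb ⊢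
    rw [map_add, ha, hb]
  zero_mem' := map_zero _
  smul_mem' c a ha := by
    simp only [Set.mem_ofPred_eq] at ha ⊢
    rw [map_smul, ha]
  lie_mem' {a b} ha hb := by
    change lieMap σ.hom a = a at ha
    change lieMap σ.hom b = b at hb
    change lieMap σ.hom ⁅a, b⁆ = ⁅a, b⁆
    rw [lieMap_bracket σ.smooth σ.invol, ha, hb]

/-- `𝓚`, the eigenspace of `σ` for `-1`. -/
def 𝓚 : Submodule ℝ (GroupLieAlgebra (𝓡 n) G) where
  carrier := {X | lieMap σ.hom X = -X}
  add_mem' {a b} ha hb := by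
    simp only [Set.mem_ofPred_eq] at ha hb ⊢
    rw [map_add, ha, hb, neg_add]
  zero_mem' := by simp
  smul_mem' c a ha := by
    simp only [Set.mem_ofPred_eq] at ha ⊢
    rw [map_smul, ha, smul_neg]

/-- `σ` is a Cartan involution: the form `-(X, σ X)` built from the Killing form is positive
definite. Then `G` is semisimple and `G / H` is a symmetric space of noncompact type. -/
def IsCartan : Prop :=
  ∀ X : GroupLieAlgebra (𝓡 n) G, X ≠ 0 →
    killingForm ℝ (GroupLieAlgebra (𝓡 n) G) X (lieMap σ.hom X) < 0

/-- `𝓐` is a maximal commuting subspace of `𝓚`. -/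
def IsCartanSubspace (𝓐 : Submodule ℝ (GroupLieAlgebra (𝓡 n) G)) : Prop :=
  Maximal (fun W => W ≤ σ.𝓚 ∧ ∀ X ∈ W, ∀ Y ∈ W, ⁅X, Y⁆ = 0) 𝓐

/-- `𝓑 ⊆ 𝓗` extends `𝓐` to a maximal commutative subalgebra `𝓐 ⊕ 𝓑` of the Lie algebra. -/
def IsCommutativeExtension (𝓐 : Submodule ℝ (GroupLieAlgebra (𝓡 n) G))
    (𝓑 : Submodule ℝ σ.𝓗) : Prop :=
  Maximal (fun W : Submodule ℝ (GroupLieAlgebra (𝓡 n) G) => ∀ X ∈ W, ∀ Y ∈ W, ⁅X, Y⁆ = 0)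
    (𝓐 ⊔ 𝓑.map σ.𝓗.toSubmodule.subtype)

/-- The adjoint action of `H` on `𝓗`. -/
def AdH (h : σ.H) : σ.𝓗 →ₗ[ℝ] σ.𝓗 :=
  ((Ad (h : G) : GroupLieAlgebra (𝓡 n) G →L[ℝ] GroupLieAlgebra (𝓡 n) G).toLinearMap).restrict
    (p := σ.𝓗.toSubmodule) (q := σ.𝓗.toSubmodule) (by
    intro X hX
    change lieMap σ.hom X = X at hX
    change lieMap σ.hom (Ad (h : G) X) = Ad (h : G) X
    have hh : σ.hom (h : G) = h := h.2
    have e : σ.hom.comp (MulAut.conj (h : G)).toMonoidHom =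
        (MulAut.conj (h : G)).toMonoidHom.comp σ.hom := by
      ext x
      simp [hh]
    unfold Ad
    rw [← lieMap_comp _ _ σ.smooth (contMDiff_conj _), e,
      lieMap_comp _ _ (contMDiff_conj _) σ.smooth, hX])

/-! ## The momentum -/

/-- The skew form `χ (X, Y) = μ ([X, Y])` on `𝓗` attached to `μ ∈ 𝓗*`. -/
def χ (μ : Module.Dual ℝ σ.𝓗) : σ.𝓗 →ₗ[ℝ] σ.𝓗 →ₗ[ℝ] ℝ :=
  LinearMap.mk₂ ℝ (fun X Y => μ ⁅X, Y⁆) (by simp) (by simp) (by simp) (by simp)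

/-- The isotropy group `H_μ ⊆ H` of `μ` for the coadjoint action
`(Ad*_h μ) (X) = μ (h⁻¹ X h)`. -/
def isotropyGroup (μ : Module.Dual ℝ σ.𝓗) : Set G :=
  {g | ∃ h : σ.H, (h : G) = g ∧ ∀ X, μ (σ.AdH h⁻¹ X) = μ X}

/-- The isotropy algebra `𝓗_μ = {X ∈ 𝓗 | μ ([X, Y]) = 0 for all Y ∈ 𝓗}`. -/
def 𝓗μ (μ : Module.Dual ℝ σ.𝓗) : Submodule ℝ σ.𝓗 := LinearMap.ker (σ.χ μ)

/-- `μ̂ : 𝓗 / 𝓗_μ → 𝓗*`, `μ̂ (Y) (X) = χ (X, Y)`. Its values vanish on `𝓗_μ`. -/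
def muHat (μ : Module.Dual ℝ σ.𝓗) : (σ.𝓗 ⧸ σ.𝓗μ μ) →ₗ[ℝ] Module.Dual ℝ σ.𝓗 :=
  (σ.𝓗μ μ).liftQ (σ.χ μ).flip (by
    intro Y hY
    have hY' : σ.χ μ Y = 0 := hY
    ext X
    have h := LinearMap.congr_fun hY' X
    change μ ⁅Y, X⁆ = 0 at h
    change μ ⁅X, Y⁆ = 0
    rw [← lie_skew, map_neg, h, neg_zero])

/-- (The image of) `W` is a maximal isotropic subspace of `𝓗 / 𝓗_μ` for the form induced by `χ`.
Maximal isotropic subspaces of `𝓗 / 𝓗_μ` correspond to those of `𝓗`, which all contain the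
kernel `𝓗_μ` of `χ`. -/
def IsMaxIsotropic (μ : Module.Dual ℝ σ.𝓗) (W : Submodule ℝ σ.𝓗) : Prop :=
  Maximal (fun U : Submodule ℝ σ.𝓗 => ∀ X ∈ U, ∀ Y ∈ U, σ.χ μ X Y = 0) (σ.𝓗μ μ ⊔ W)

/-- `𝓗 = 𝓗_μ ⊕ 𝓑 ⊕ 𝓒`, with `𝓑` and `𝓒` maximal isotropic for `χ`. -/
structure IsLagrangianSplitting (μ : Module.Dual ℝ σ.𝓗) (𝓑 𝓒 : Submodule ℝ σ.𝓗) : Prop where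
  disjoint : Disjoint (σ.𝓗μ μ) 𝓑
  isCompl : IsCompl (σ.𝓗μ μ ⊔ 𝓑) 𝓒
  maxIsotropic_left : σ.IsMaxIsotropic μ 𝓑
  maxIsotropic_right : σ.IsMaxIsotropic μ 𝓒

/-- The left moment map `𝓟ᴸ (g, ξ) = (Ad*_g ξ)|_𝓗` on `T*G = G × 𝓖*` (left trivialization). -/
def momentL (p : G × Module.Dual ℝ (GroupLieAlgebra (𝓡 n) G)) : Module.Dual ℝ σ.𝓗 :=
  (p.2 ∘ₗ (Ad p.1⁻¹).toLinearMap) ∘ₗ σ.𝓗.toSubmodule.subtype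

/-- The right moment map `𝓟ᴿ (g, ξ) = - ξ|_𝓗`. -/
def momentR (p : G × Module.Dual ℝ (GroupLieAlgebra (𝓡 n) G)) : Module.Dual ℝ σ.𝓗 :=
  -(p.2 ∘ₗ σ.𝓗.toSubmodule.subtype)

/-- The level set `N_μ`, for the momentum `(μ, 0)`. -/
def levelSet (μ : Module.Dual ℝ σ.𝓗) :
    Set (G × Module.Dual ℝ (GroupLieAlgebra (𝓡 n) G)) :=
  {p | σ.momentL p = μ ∧ σ.momentR p = 0}

end SmoothInvolution

/-- `α` is a root of the symmetric space: a nonzero linear form on `𝓐` which admits a root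
vector. -/
def IsRestrictedRoot (𝓐 : Submodule ℝ (GroupLieAlgebra (𝓡 n) G)) (α : Module.Dual ℝ 𝓐) : Prop :=
  α ≠ 0 ∧ ∃ e : GroupLieAlgebra (𝓡 n) G, e ≠ 0 ∧
    ∀ x : 𝓐, ⁅(x : GroupLieAlgebra (𝓡 n) G), e⁆ = α x • e

/-- `q ∈ 𝓐` is regular, i.e. lies in some open Weyl chamber. -/
def IsRegular (𝓐 : Submodule ℝ (GroupLieAlgebra (𝓡 n) G)) (q : 𝓐) : Prop :=
  ∀ α : Module.Dual ℝ 𝓐, IsRestrictedRoot 𝓐 α → α q ≠ 0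

namespace SmoothInvolution

variable (σ : SmoothInvolution n G)

/-- `(Q, L)` is the point of the section `𝓢` of `N_μ` with position `q`:
`Q = exp q` with `q ∈ 𝓐` regular, and `(Q, L) ∈ N_μ`. -/
structure IsSectionPoint (𝓐 : Submodule ℝ (GroupLieAlgebra (𝓡 n) G)) (μ : Module.Dual ℝ σ.𝓗)
    (q : 𝓐) (Q : G) (L : Module.Dual ℝ (GroupLieAlgebra (𝓡 n) G)) : Prop where
  regular : IsRegular 𝓐 q
  exp : IsExp (q : GroupLieAlgebra (𝓡 n) G) Q
  mem : (Q, L) ∈ σ.levelSet μ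

/-- `h₂` is an admissible choice, near `Q = exp q`, of the right factor in the decomposition
`g = h₁ a h₂` with `h₁, h₂ ∈ H`, `a ∈ exp 𝓐`: it is smooth, it depends on `g` only, and it
reduces to the uniquely determined right factor `k` at the points
`g = h a k`, `h ∈ H_μ`, `a ∈ exp 𝓐`, `k ∈ H`, over which `N_μ` lies. All conditions are local,
for `(h, log a, k)` near `(1, q, 1)`; in particular `h₂ Q = 1`. -/
structure IsRightFactor (𝓐 : Submodule ℝ (GroupLieAlgebra (𝓡 n) G)) (μ : Module.Dual ℝ σ.𝓗)
    (q : 𝓐) (Q : G) (h₂ : G → G) : Prop where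
  smooth : ContMDiffAt (𝓡 n) (𝓡 n) ∞ h₂ Q
  decomp : ∀ᶠ g in 𝓝 Q, h₂ g ∈ σ.H ∧ ∃ h₁ ∈ σ.H, ∃ x ∈ 𝓐, ∃ a, IsExp x a ∧ g = h₁ * a * h₂ g
  onLevel : ∀ᶠ p : G × GroupLieAlgebra (𝓡 n) G × G in 𝓝 (1, (q : GroupLieAlgebra (𝓡 n) G), 1),
    p.1 ∈ σ.isotropyGroup μ → p.2.1 ∈ 𝓐 → p.2.2 ∈ σ.H →
      ∀ a, IsExp p.2.1 a → h₂ (p.1 * a * p.2.2) = p.2.2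

/-! ## The function `D_Q`, the correction vector and the `R`-matrix -/

/-- `D_Q (X) = ∇_g h₂ (Q⁻¹ X Q)` for `X ∈ 𝓗`. -/
def DQ (h₂ : G → G) (Q : G) : σ.𝓗 →ₗ[ℝ] GroupLieAlgebra (𝓡 n) G :=
  ((nabla h₂ Q).toLinearMap ∘ₗ (Ad Q⁻¹).toLinearMap) ∘ₗ σ.𝓗.toSubmodule.subtype

/-- The linear form `λ_Z : X ↦ ⟨L, [Z, D_Q (X)]⟩` on `𝓗`. -/
def lam (h₂ : G → G) (Q : G) (L : Module.Dual ℝ (GroupLieAlgebra (𝓡 n) G))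
    (Z : GroupLieAlgebra (𝓡 n) G) : Module.Dual ℝ σ.𝓗 :=
  L ∘ₗ (LieAlgebra.ad ℝ (GroupLieAlgebra (𝓡 n) G) Z) ∘ₗ σ.DQ h₂ Q

/-- `v ∈ 𝓗 / 𝓗_μ` is the correction vector of `Z`, that is `v = μ̂⁻¹ (λ_Z)`; equivalently
`⟨μ, [X, v]⟩ = ⟨L, [Z, D_Q (X)]⟩` for all `X ∈ 𝓗`. -/
def IsCorrection (μ : Module.Dual ℝ σ.𝓗) (h₂ : G → G) (Q : G)
    (L : Module.Dual ℝ (GroupLieAlgebra (𝓡 n) G)) (Z : σ.𝓚) (v : σ.𝓗 ⧸ σ.𝓗μ μ) : Prop :=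
  σ.muHat μ v = σ.lam h₂ Q L Z

/-- `R : 𝓚 → 𝓗` is the `R`-matrix `R (Z) = ∇_g h₂ (Z) + (1/2) D_Q (V_Z)`, where `V` runs over
the representatives in `𝓗` of the correction vector `V_Z`. -/
def IsRMatrix (μ : Module.Dual ℝ σ.𝓗) (h₂ : G → G) (Q : G)
    (L : Module.Dual ℝ (GroupLieAlgebra (𝓡 n) G)) (R : σ.𝓚 →ₗ[ℝ] σ.𝓗) : Prop :=
  ∀ (Z : σ.𝓚) (V : σ.𝓗), σ.IsCorrection μ h₂ Q L Z ((σ.𝓗μ μ).mkQ V) →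
    (R Z : GroupLieAlgebra (𝓡 n) G) =
      nabla h₂ Q (Z : GroupLieAlgebra (𝓡 n) G) + (1 / 2 : ℝ) • σ.DQ h₂ Q V

end SmoothInvolution

end

end Calogero

/-! The correction term vanishes because `D_Q` is zero on all of `𝓗_μ ⊕ 𝓒` and `V_Z` has nowhere
else to lie. On `𝓒` this is the hypothesis on `h₂`. On `𝓗_μ` it holds because `h₂ = 1` on `H_μ Q`
near `Q` (`IsRightFactor.DQ_eq_zero`). Hence `λ_Z` annihilates `𝓗_μ ⊕ 𝓒`.

The rest is symplectic linear algebra. The map `μ̂` is injective, and by a dimension count its range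
is the annihilator of `𝓗_μ` (`range_muHat`), so `μ̂ V = λ_Z` has exactly one solution, linear in
`Z`. Since `λ_Z` kills `𝓒`, this solution is `χ`-orthogonal to `𝓒`. A maximal isotropic subspace is
its own orthogonal (`IsMaxIsotropic.mem_of_orthogonal`), so `V_Z` comes from `𝓒` and `D_Q (V_Z) =
0`.

The analytic work is the passage from the isotropy algebra to the isotropy group: an integral curve
through `1` of the left-invariant field of `X ∈ 𝓗_μ` stays in `H_μ` for small times
(`eventually_mem_isotropyGroup`). This rests on `d/dt Ad (γ t) Y = Ad (γ t) [X, Y]`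
(`hasDerivAt_Ad`), where the bracket is that of left-invariant vector fields; the formula is checked
at the identity in a chart and then translated. -/

namespace Calogero

noncomputable section

/-! ### Second-order calculus of a local group law in coordinates. -/

section Calculus

variable {E : Type*} [NormedAddCommGroup E] [NormedSpace ℝ E]

theorem eventually_fderiv_right_eq {F : Type*} [NormedAddCommGroup F] [NormedSpace ℝ F]
    {f : E × E → F} {e : E} (hf : ContDiffAt ℝ 2 f (e, e)) :
    (fun a => fderiv ℝ (fun b => f (a, b)) e) =ᶠ[𝓝 e]
      fun a => (fderiv ℝ f (a, e)).comp (ContinuousLinearMap.inr ℝ E E) := by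
  have h1 : ∀ᶠ p in 𝓝 (e, e), DifferentiableAt ℝ f p :=
    (hf.eventually (by simp)).mono fun p hp => hp.differentiableAt (by simp)
  have h2 : Filter.Tendsto (fun a : E => (a, e)) (𝓝 e) (𝓝 (e, e)) :=
    Continuous.tendsto (by fun_prop) e
  filter_upwards [h2.eventually h1] with a ha
  exact (HasFDerivAt.comp e ha.hasFDerivAt (hasFDerivAt_prodMk_right a e)).fderiv

/-- With `f` the multiplication this differentiates a left-invariant field; with `f` the conjugation
it differentiates the adjoint action. Both derivatives are mixed second derivatives of `f`. -/
theorem hasFDerivAt_fderiv_right {F : Type*} [NormedAddCommGroup F] [NormedSpace ℝ F]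
    {f : E × E → F} {e : E} (hf : ContDiffAt ℝ 2 f (e, e)) (Y : E) :
    HasFDerivAt (fun a => fderiv ℝ (fun b => f (a, b)) e Y)
      (((fderiv ℝ (fderiv ℝ f) (e, e)).flip (0, Y)).comp (ContinuousLinearMap.inl ℝ E E)) e := by
  have hd : HasFDerivAt (fderiv ℝ f) (fderiv ℝ (fderiv ℝ f) (e, e)) (e, e) :=
    ((hf.fderiv_right (m := 1) (by norm_num)).differentiableAt (by simp)).hasFDerivAt
  have h1 := HasFDerivAt.comp (f := fun a : E => (a, e)) e hd (hasFDerivAt_prodMk_left e e)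
  have h2 := h1.clm_apply (hasFDerivAt_const ((0 : E), Y) e)
  have h3 : (fun a => fderiv ℝ (fun b => f (a, b)) e Y) =ᶠ[𝓝 e]
      fun a => fderiv ℝ f (a, e) (0, Y) := by
    filter_upwards [eventually_fderiv_right_eq hf] with a ha
    rw [ha]; simp
  refine HasFDerivAt.congr_of_eventuallyEq ?_ h3
  convert! h2 using 1
  ext v
  simp

/-- In coordinates `m` for the multiplication and `K` for the conjugation of a Lie group near its
identity `e`, the derivative of the adjoint action is the Lie bracket of left-invariant fields. -/
theorem hasFDerivAt_conj_eq_lieBracket {m K : E × E → E} {e : E}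
    (hm : ContDiffAt ℝ 2 m (e, e)) (hK : ContDiffAt ℝ 2 K (e, e))
    (hm1 : ∀ᶠ a in 𝓝 e, m (a, e) = a) (hm2 : ∀ᶠ a in 𝓝 e, m (e, a) = a)
    (hK1 : ∀ᶠ a in 𝓝 e, K (a, e) = e) (hK2 : ∀ᶠ b in 𝓝 e, K (e, b) = b)
    (hKm : ∀ᶠ p in 𝓝 (e, e), m (K p, p.1) = m p) (Y : E) :
    ∃ T : E →L[ℝ] E, HasFDerivAt (fun a => fderiv ℝ (fun b => K (a, b)) e Y) T e ∧
      ∀ X, T X = lieBracket ℝ (fun a => fderiv ℝ (fun b => m (a, b)) e X)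
        (fun a => fderiv ℝ (fun b => m (a, b)) e Y) e := by
  refine ⟨_, hasFDerivAt_fderiv_right hK Y, fun X => ?_⟩
  set S := fderiv ℝ (fderiv ℝ m) (e, e)
  have hsymm : ∀ v w, S v w = S w v := hm.isSymmSndFDerivAt (by simp)
  have hmd : HasFDerivAt (fderiv ℝ m) S (e, e) :=
    ((hm.fderiv_right (m := 1) (by norm_num)).differentiableAt (by simp)).hasFDerivAt
  have hid : ∀ Z, fderiv ℝ (fun b => m (e, b)) e Z = Z := fun Z => by
    have : (fun b => m (e, b)) =ᶠ[𝓝 e] id := hm2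
    rw [this.fderiv_eq, fderiv_id]; rfl
  have hidK : ∀ Z, fderiv ℝ (fun b => K (e, b)) e Z = Z := fun Z => by
    have : (fun b => K (e, b)) =ᶠ[𝓝 e] id := hK2
    rw [this.fderiv_eq, fderiv_id]; rfl
  have hlin : ∀ v : E, fderiv ℝ m (e, e) (v, 0) = v := by
    intro v
    have h1 : HasFDerivAt (fun a => m (a, e)) _ e := HasFDerivAt.comp e
      ((hm.differentiableAt (by simp)).hasFDerivAt) (hasFDerivAt_prodMk_left (𝕜 := ℝ) e e)
    have h2 : (fun a => m (a, e)) =ᶠ[𝓝 e] id := hm1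
    have h3 := h1.fderiv
    rw [h2.fderiv_eq, fderiv_id] at h3
    simpa using (congrArg (fun T => T v) h3).symm
  -- differentiate `m (K (a, b), a) = m (a, b)` in `b` at `e`
  have hrel : (fun a => fderiv ℝ m (e, a) (fderiv ℝ (fun b => K (a, b)) e Y, 0)) =ᶠ[𝓝 e]
      fun a => fderiv ℝ (fun b => m (a, b)) e Y := by
    have t : Filter.Tendsto (fun a : E => (a, e)) (𝓝 e) (𝓝 (e, e)) :=
      Continuous.tendsto (by fun_prop) e
    have t' : Filter.Tendsto (fun a : E => (e, a)) (𝓝 e) (𝓝 (e, e)) :=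
      Continuous.tendsto (by fun_prop) e
    have dm := (hm.eventually (by simp)).mono fun p hp => hp.differentiableAt (by simp)
    have dK := (hK.eventually (by simp)).mono fun p hp => hp.differentiableAt (by simp)
    filter_upwards [t'.eventually dm, t.eventually dK, t.eventually hKm.eventually_nhds, hK1]
      with a h1 h2 h3 h4
    have ta : Filter.Tendsto (fun b : E => (a, b)) (𝓝 e) (𝓝 (a, e)) :=
      Continuous.tendsto (by fun_prop) e
    have h5 : (fun b => m (K (a, b), a)) =ᶠ[𝓝 e] fun b => m (a, b) := ta.eventually h3
    rw [← h5.fderiv_eq]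
    have h6 : DifferentiableAt ℝ (fun b => K (a, b)) e :=
      DifferentiableAt.comp e h2 (hasFDerivAt_prodMk_right a e).differentiableAt
    have h7 : HasFDerivAt (fun b => (K (a, b), a)) _ e :=
      h6.hasFDerivAt.prodMk (hasFDerivAt_const a e)
    have h8 : HasFDerivAt m (fderiv ℝ m (e, a)) (K (a, e), a) := by
      rw [h4]; exact h1.hasFDerivAt
    have h9 : HasFDerivAt (fun b => m (K (a, b), a)) _ e := HasFDerivAt.comp e h8 h7
    rw [h9.fderiv]
    simp
  have hY := hasFDerivAt_fderiv_right hm Y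
  have hX := hasFDerivAt_fderiv_right hm X
  have hKY := hasFDerivAt_fderiv_right hK Y
  -- Differentiating `hrel` at `e` in the direction `X` by the product rule gives `S (0, X) (Y, 0) +
  -- T X = S (X, 0) (0, Y)`, where `T` is the derivative of the adjoint action.
  have hl := (HasFDerivAt.comp e hmd (hasFDerivAt_prodMk_right (𝕜 := ℝ) e e)).clm_apply
    (hKY.prodMk (hasFDerivAt_const (0 : E) e))
  have hu := hl.unique (hY.congr_of_eventuallyEq hrel)
  have hu' := congrArg (fun T => T X) hu
  simp [hlin, hidK] at hu'
  rw [lieBracket, hY.fderiv, hX.fderiv, hid, hid]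
  simp
  -- The bracket is `S (X, 0) (0, Y) - S (Y, 0) (0, X)`; symmetry of `S` matches its second term
  -- with the one in `hu'`.
  rw [hsymm (Y, 0) (0, X)]
  rw [← hu']
  abel

end Calculus

/-! ### The Lie bracket and the adjoint action in the chart at the identity. -/

section Chart

variable {n : ℕ} {G : Type*} [TopologicalSpace G] [ChartedSpace (EuclideanSpace ℝ (Fin n)) G]
  [Group G]

variable (n G) in
/-- The coordinates of the identity in the preferred chart at the identity. -/
def chartOne : EuclideanSpace ℝ (Fin n) := extChartAt (𝓡 n) (1 : G) 1

variable (n G) in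
/-- The multiplication of `G` in the preferred chart at the identity. -/
def mulChart (p : EuclideanSpace ℝ (Fin n) × EuclideanSpace ℝ (Fin n)) :
    EuclideanSpace ℝ (Fin n) :=
  extChartAt (𝓡 n) (1 : G) ((extChartAt (𝓡 n) (1 : G)).symm p.1 *
    (extChartAt (𝓡 n) (1 : G)).symm p.2)

variable (n G) in
/-- The conjugation `(a, b) ↦ a b a⁻¹` of `G` in the preferred chart at the identity. -/
def conjChart (p : EuclideanSpace ℝ (Fin n) × EuclideanSpace ℝ (Fin n)) :
    EuclideanSpace ℝ (Fin n) :=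
  extChartAt (𝓡 n) (1 : G) ((extChartAt (𝓡 n) (1 : G)).symm p.1 *
    (extChartAt (𝓡 n) (1 : G)).symm p.2 * ((extChartAt (𝓡 n) (1 : G)).symm p.1)⁻¹)

theorem extChartAt_symm_chartOne : (extChartAt (𝓡 n) (1 : G)).symm (chartOne n G) = 1 :=
  extChartAt_to_inv (I := 𝓡 n) (1 : G)

theorem eventually_mem_target_chartOne :
    ∀ᶠ a in 𝓝 (chartOne n G), a ∈ (extChartAt (𝓡 n) (1 : G)).target :=
  extChartAt_target_mem_nhds (I := 𝓡 n) (1 : G)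

/-- As `f` fixes `1`, the same chart serves source and target, and no change of coordinates enters.
-/
theorem mfderiv_eq_fderiv_chartOne {f : G → G} (hf : MDifferentiableAt (𝓡 n) (𝓡 n) f 1)
    (h1 : f 1 = 1) (Y : GroupLieAlgebra (𝓡 n) G) :
    (mfderiv (𝓡 n) (𝓡 n) f 1 Y : EuclideanSpace ℝ (Fin n)) =
      fderiv ℝ (fun b => extChartAt (𝓡 n) (1 : G) (f ((extChartAt (𝓡 n) (1 : G)).symm b)))
        (chartOne n G) Y := by
  rw [hf.mfderiv]
  unfold writtenInExtChartAt
  rw [h1, ModelWithCorners.range_eq_univ, fderivWithin_univ]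
  rfl

variable [LieGroup (𝓡 n) ∞ G]

theorem contMDiffAt_extChartAt_symm_chartOne :
    ContMDiffAt 𝓘(ℝ, EuclideanSpace ℝ (Fin n)) (𝓡 n) ∞ (extChartAt (𝓡 n) (1 : G)).symm
      (chartOne n G) :=
  (contMDiffOn_extChartAt_symm (I := 𝓡 n) (n := ∞) (1 : G)).contMDiffAt
    eventually_mem_target_chartOne

theorem contMDiffAt_extChartAt_symm_fst :
    ContMDiffAt 𝓘(ℝ, EuclideanSpace ℝ (Fin n) × EuclideanSpace ℝ (Fin n)) (𝓡 n) ∞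
        (fun p => (extChartAt (𝓡 n) (1 : G)).symm p.1) (chartOne n G, chartOne n G) :=
  ContMDiffAt.comp (I' := 𝓘(ℝ, EuclideanSpace ℝ (Fin n))) _
    contMDiffAt_extChartAt_symm_chartOne contDiff_fst.contMDiff.contMDiffAt

theorem contMDiffAt_extChartAt_symm_snd :
    ContMDiffAt 𝓘(ℝ, EuclideanSpace ℝ (Fin n) × EuclideanSpace ℝ (Fin n)) (𝓡 n) ∞
        (fun p => (extChartAt (𝓡 n) (1 : G)).symm p.2) (chartOne n G, chartOne n G) :=
  ContMDiffAt.comp (I' := 𝓘(ℝ, EuclideanSpace ℝ (Fin n))) _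
    contMDiffAt_extChartAt_symm_chartOne contDiff_snd.contMDiff.contMDiffAt

theorem contDiffAt_mulChart : ContDiffAt ℝ 2 (mulChart n G) (chartOne n G, chartOne n G) := by
  rw [← contMDiffAt_iff_contDiffAt]
  have h1 := contMDiffAt_extChartAt_symm_fst (n := n) (G := G)
  have h2 := contMDiffAt_extChartAt_symm_snd (n := n) (G := G)
  have h3 : ContMDiffAt (𝓡 n) 𝓘(ℝ, EuclideanSpace ℝ (Fin n)) ∞ (extChartAt (𝓡 n) (1 : G))
      ((extChartAt (𝓡 n) (1 : G)).symm (chartOne n G) *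
        (extChartAt (𝓡 n) (1 : G)).symm (chartOne n G)) := by
    rw [extChartAt_symm_chartOne, mul_one]
    exact contMDiffAt_extChartAt
  exact (ContMDiffAt.comp (chartOne n G, chartOne n G) h3 (h1.mul h2)).of_le
    ENat.LEInfty.out

theorem contDiffAt_conjChart : ContDiffAt ℝ 2 (conjChart n G) (chartOne n G, chartOne n G) := by
  rw [← contMDiffAt_iff_contDiffAt]
  have h1 := contMDiffAt_extChartAt_symm_fst (n := n) (G := G)
  have h2 := contMDiffAt_extChartAt_symm_snd (n := n) (G := G)
  have h3 : ContMDiffAt (𝓡 n) 𝓘(ℝ, EuclideanSpace ℝ (Fin n)) ∞ (extChartAt (𝓡 n) (1 : G))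
      ((extChartAt (𝓡 n) (1 : G)).symm (chartOne n G) *
        (extChartAt (𝓡 n) (1 : G)).symm (chartOne n G) *
        ((extChartAt (𝓡 n) (1 : G)).symm (chartOne n G))⁻¹) := by
    rw [extChartAt_symm_chartOne, mul_one, inv_one, mul_one]
    exact contMDiffAt_extChartAt
  exact (ContMDiffAt.comp (chartOne n G, chartOne n G) h3 ((h1.mul h2).mul h1.inv)).of_le
    ENat.LEInfty.out

theorem hasMFDerivAt_extChartAt_symm_chartOne :
    HasMFDerivAt 𝓘(ℝ, EuclideanSpace ℝ (Fin n)) (𝓡 n) (extChartAt (𝓡 n) (1 : G)).symm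
      (chartOne n G) (ContinuousLinearMap.id ℝ (EuclideanSpace ℝ (Fin n))) := by
  have h := (contMDiffAt_extChartAt_symm_chartOne (n := n) (G := G)).mdifferentiableAt (by simp)
  have h2 := mfderivWithin_range_extChartAt_symm (I := 𝓡 n) (x := (1 : G))
  rw [ModelWithCorners.range_eq_univ, mfderivWithin_univ] at h2
  have h3 := h.hasMFDerivAt
  unfold chartOne at h3 ⊢
  rw [h2] at h3
  exact h3

/-- The left-invariant field at `g` is the derivative at `1` of left translation by `g`, so in the
chart it is the partial derivative of the multiplication in its second argument. -/
theorem mpullbackWithin_mulInvariantVectorField (Y : GroupLieAlgebra (𝓡 n) G) :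
    mpullbackWithin 𝓘(ℝ, EuclideanSpace ℝ (Fin n)) (𝓡 n) (extChartAt (𝓡 n) (1 : G)).symm
      (mulInvariantVectorField Y) (Set.range (𝓡 n)) =ᶠ[𝓝 (chartOne n G)]
      fun a => fderiv ℝ (fun b => mulChart n G (a, b)) (chartOne n G) Y := by
  filter_upwards [eventually_mem_target_chartOne (n := n) (G := G)] with a ha
  set φ := extChartAt (𝓡 n) (1 : G) with hφ
  have hs : φ.symm a ∈ φ.source := φ.map_target ha
  have hinv : (mfderivWithin 𝓘(ℝ, EuclideanSpace ℝ (Fin n)) (𝓡 n) φ.symm (Set.range (𝓡 n)) a).inverse =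
      mfderiv (𝓡 n) 𝓘(ℝ, EuclideanSpace ℝ (Fin n)) φ (φ.symm a) :=
    ContinuousLinearMap.inverse_eq
      (by
        have := mfderivWithin_extChartAt_symm_comp_mfderiv_extChartAt (I := 𝓡 n) ha
        exact this)
      (mfderiv_extChartAt_comp_mfderivWithin_extChartAt_symm (I := 𝓡 n) ha)
  rw [mpullbackWithin_apply, hinv]
  have h1 : HasMFDerivAt (𝓡 n) (𝓡 n) (fun b : G => φ.symm a * b) (φ.symm (chartOne n G))
      (mfderiv (𝓡 n) (𝓡 n) (fun b : G => φ.symm a * b) 1) := by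
    rw [hφ, extChartAt_symm_chartOne]
    exact ((contMDiff_mul_left (I := 𝓡 n) (n := ∞) (1 : G)).mdifferentiableAt
      (by simp)).hasMFDerivAt
  have h2 : HasMFDerivAt (𝓡 n) 𝓘(ℝ, EuclideanSpace ℝ (Fin n)) φ
      (φ.symm a * φ.symm (chartOne n G))
      (mfderiv (𝓡 n) 𝓘(ℝ, EuclideanSpace ℝ (Fin n)) φ (φ.symm a)) := by
    rw [hφ, extChartAt_symm_chartOne, mul_one]
    exact (mdifferentiableAt_extChartAt (by simpa [hφ] using hs)).hasMFDerivAt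
  have h3 := HasMFDerivAt.comp (chartOne n G) (HasMFDerivAt.comp _ h2 h1)
    (hasMFDerivAt_extChartAt_symm_chartOne (n := n) (G := G))
  let A : EuclideanSpace ℝ (Fin n) →L[ℝ] EuclideanSpace ℝ (Fin n) :=
    mfderiv (𝓡 n) 𝓘(ℝ, EuclideanSpace ℝ (Fin n)) φ (φ.symm a)
  let B : EuclideanSpace ℝ (Fin n) →L[ℝ] EuclideanSpace ℝ (Fin n) :=
    mfderiv (𝓡 n) (𝓡 n) (fun b : G => φ.symm a * b) 1
  have h4 : HasFDerivAt (fun b => mulChart n G (a, b))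
      ((A.comp B).comp (ContinuousLinearMap.id ℝ (EuclideanSpace ℝ (Fin n)))) (chartOne n G) :=
    hasMFDerivAt_iff_hasFDerivAt.1 h3
  rw [h4.fderiv]
  rfl

theorem bracket_eq_lieBracket_mulChart (X Y : GroupLieAlgebra (𝓡 n) G) :
    (⁅X, Y⁆ : GroupLieAlgebra (𝓡 n) G) =
      lieBracket ℝ (fun a => fderiv ℝ (fun b => mulChart n G (a, b)) (chartOne n G) X)
        (fun a => fderiv ℝ (fun b => mulChart n G (a, b)) (chartOne n G) Y) (chartOne n G) := by
  rw [GroupLieAlgebra.bracket_def, ← mlieBracketWithin_univ, mlieBracketWithin_apply]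
  have hinv : (mfderiv (𝓡 n) 𝓘(ℝ, EuclideanSpace ℝ (Fin n)) (extChartAt (𝓡 n) (1 : G)) 1 :
      EuclideanSpace ℝ (Fin n) →L[ℝ] EuclideanSpace ℝ (Fin n)).inverse =
      ContinuousLinearMap.id ℝ (EuclideanSpace ℝ (Fin n)) :=
    (congrArg (fun T : EuclideanSpace ℝ (Fin n) →L[ℝ] EuclideanSpace ℝ (Fin n) => T.inverse)
      (mfderiv_extChartAt_self (I := 𝓡 n) (x := (1 : G)))).trans ContinuousLinearMap.inverse_id
  refine (congrArg (fun T : EuclideanSpace ℝ (Fin n) →L[ℝ] EuclideanSpace ℝ (Fin n) => T _)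
    hinv).trans ?_
  have h1 : (extChartAt (𝓡 n) (1 : G)).symm ⁻¹' Set.univ ∩ Set.range (𝓡 n) = Set.univ := by
    simp
  rw [h1]
  refine (congrFun lieBracketWithin_univ _).trans ?_
  exact (mpullbackWithin_mulInvariantVectorField X).lieBracket_vectorField_eq
    (mpullbackWithin_mulInvariantVectorField Y)

theorem Ad_extChartAt_symm (a : EuclideanSpace ℝ (Fin n)) (Y : GroupLieAlgebra (𝓡 n) G) :
    (Ad ((extChartAt (𝓡 n) (1 : G)).symm a) Y : EuclideanSpace ℝ (Fin n)) =
      fderiv ℝ (fun b => conjChart n G (a, b)) (chartOne n G) Y :=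
  mfderiv_eq_fderiv_chartOne ((contMDiff_conj _ 1).mdifferentiableAt (by simp)) (map_one _) Y

theorem hasFDerivAt_Ad_chart (Y : GroupLieAlgebra (𝓡 n) G) :
    ∃ T : EuclideanSpace ℝ (Fin n) →L[ℝ] EuclideanSpace ℝ (Fin n),
      HasFDerivAt (F := EuclideanSpace ℝ (Fin n))
        (fun a => Ad ((extChartAt (𝓡 n) (1 : G)).symm a) Y) T (chartOne n G) ∧
      ∀ X : GroupLieAlgebra (𝓡 n) G, T X = (⁅X, Y⁆ : GroupLieAlgebra (𝓡 n) G) := by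
  have ht := eventually_mem_target_chartOne (n := n) (G := G)
  have hc : ContinuousAt (fun p : EuclideanSpace ℝ (Fin n) × EuclideanSpace ℝ (Fin n) =>
      (extChartAt (𝓡 n) (1 : G)).symm p.1 * (extChartAt (𝓡 n) (1 : G)).symm p.2 *
        ((extChartAt (𝓡 n) (1 : G)).symm p.1)⁻¹) (chartOne n G, chartOne n G) := by
    have : IsTopologicalGroup G := topologicalGroup_of_lieGroup (𝓡 n) ∞
    have h0 := (contMDiffAt_extChartAt_symm_chartOne (n := n) (G := G)).continuousAt
    have h1 := ContinuousAt.comp (f := Prod.fst) (x := (chartOne n G, chartOne n G))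
      h0 continuousAt_fst
    have h2 := ContinuousAt.comp (f := Prod.snd) (x := (chartOne n G, chartOne n G))
      h0 continuousAt_snd
    exact (h1.mul h2).mul h1.inv
  -- The relation `(a b a⁻¹) a = a b` passes to coordinates only where `a b a⁻¹` stays in the chart
  -- domain.
  have hsrc : ∀ᶠ p in 𝓝 (chartOne n G, chartOne n G),
      (extChartAt (𝓡 n) (1 : G)).symm p.1 * (extChartAt (𝓡 n) (1 : G)).symm p.2 *
        ((extChartAt (𝓡 n) (1 : G)).symm p.1)⁻¹ ∈ (extChartAt (𝓡 n) (1 : G)).source := by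
    refine hc.eventually_mem ?_
    simp only [extChartAt_symm_chartOne, mul_one, inv_one]
    exact extChartAt_source_mem_nhds (I := 𝓡 n) (1 : G)
  obtain ⟨T, hT, h⟩ := hasFDerivAt_conj_eq_lieBracket (contDiffAt_mulChart (n := n) (G := G))
    contDiffAt_conjChart
    (ht.mono fun a ha => by
      simp only [mulChart, extChartAt_symm_chartOne, mul_one,
        (extChartAt (𝓡 n) (1 : G)).right_inv ha])
    (ht.mono fun a ha => by
      simp only [mulChart, extChartAt_symm_chartOne, one_mul,
        (extChartAt (𝓡 n) (1 : G)).right_inv ha])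
    (Filter.Eventually.of_forall fun a => by
      simp [conjChart, chartOne])
    (ht.mono fun a ha => by
      simp only [conjChart, extChartAt_symm_chartOne, mul_one, one_mul, inv_one,
        (extChartAt (𝓡 n) (1 : G)).right_inv ha])
    (hsrc.mono fun p hp => by
      unfold mulChart conjChart
      rw [(extChartAt (𝓡 n) (1 : G)).left_inv hp]
      simp)
    Y
  refine ⟨T, hT.congr_of_eventuallyEq (Filter.Eventually.of_forall fun a =>
    Ad_extChartAt_symm a Y), fun X => ?_⟩
  rw [h X, bracket_eq_lieBracket_mulChart]

end Chart

/-! ### The adjoint action along curves, and integral curves of left-invariant fields. -/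

section Adjoint

theorem hasMFDerivAt_comp_curve {n : ℕ} {G : Type*} [TopologicalSpace G]
    [ChartedSpace (EuclideanSpace ℝ (Fin n)) G] {f : G → G} {c : ℝ → G} {t : ℝ} {v : EuclideanSpace ℝ (Fin n)}
    (hf : MDifferentiableAt (𝓡 n) (𝓡 n) f (c t))
    (hc : HasMFDerivAt 𝓘(ℝ, ℝ) (𝓡 n) c t ((1 : ℝ →L[ℝ] ℝ).smulRight v)) :
    HasMFDerivAt 𝓘(ℝ, ℝ) (𝓡 n) (fun s => f (c s)) t
      ((1 : ℝ →L[ℝ] ℝ).smulRight (mfderiv (𝓡 n) (𝓡 n) f (c t) v : EuclideanSpace ℝ (Fin n))) := by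
  have h := HasMFDerivAt.comp t hf.hasMFDerivAt hc
  have e : ∀ T : EuclideanSpace ℝ (Fin n) →L[ℝ] EuclideanSpace ℝ (Fin n),
      T.comp ((1 : ℝ →L[ℝ] ℝ).smulRight v) = (1 : ℝ →L[ℝ] ℝ).smulRight (T v) := fun T => by
    ext1
    simp
  exact e (mfderiv (𝓡 n) (𝓡 n) f (c t)) ▸ h

variable {n : ℕ} {G : Type*} [TopologicalSpace G] [ChartedSpace (EuclideanSpace ℝ (Fin n)) G]
  [Group G]

theorem Ad_one (X : GroupLieAlgebra (𝓡 n) G) : Ad (1 : G) X = X := by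
  have : (MulAut.conj (1 : G)).toMonoidHom = MonoidHom.id G := by ext x; simp
  unfold Ad
  rw [this]
  unfold lieMap
  erw [mfderiv_id]
  rfl

variable [LieGroup (𝓡 n) ∞ G]

theorem mdifferentiableAt_mul_left (g x : G) :
    MDifferentiableAt (𝓡 n) (𝓡 n) (fun b : G => g * b) x :=
  (contMDiff_mul_left (I := 𝓡 n) (n := ∞) x).mdifferentiableAt (by simp)

theorem Ad_mul (g h : G) (X : GroupLieAlgebra (𝓡 n) G) : Ad (g * h) X = Ad g (Ad h X) := by
  unfold Ad
  rw [← lieMap_comp _ _ (contMDiff_conj _) (contMDiff_conj _)]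
  congr 2
  ext x
  simp [mul_assoc]

/-- Differentiate `φ (g x) = φ g * φ x` at `x = 1`. -/
theorem mfderiv_mulInvariantVectorField (φ : G →* G) (hφ : ContMDiff (𝓡 n) (𝓡 n) ∞ φ)
    (X : GroupLieAlgebra (𝓡 n) G) (g : G) :
    mfderiv (𝓡 n) (𝓡 n) φ g (mulInvariantVectorField X g) =
      mulInvariantVectorField (lieMap φ X) (φ g) := by
  have hd : ∀ g, MDifferentiableAt (𝓡 n) (𝓡 n) φ g := fun g => (hφ g).mdifferentiableAt (by simp)
  have e : (fun x : G => φ g * x) ∘ φ = φ ∘ (fun x : G => g * x) := by ext x; simp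
  have h1 := mfderiv_comp (I := 𝓡 n) (I' := 𝓡 n) (I'' := 𝓡 n) (1 : G)
    (mdifferentiableAt_mul_left (φ g) (φ 1)) (hd 1)
  have h2 := mfderiv_comp (I := 𝓡 n) (I' := 𝓡 n) (I'' := 𝓡 n) (1 : G) (hd (g * 1))
    (mdifferentiableAt_mul_left g 1)
  rw [e, h2] at h1
  have h3 := congrArg (fun T => T X) h1
  have h4 : φ 1 = 1 := map_one φ
  rw [h4] at h3
  have h5 : g * 1 = g := mul_one g
  rw [h5] at h3
  exact h3

/-- An automorphism pulls left-invariant fields back to left-invariant fields, and pullback commutes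
with the bracket of fields. Conjugations, which need not be involutive, require this form with a
separate inverse. -/
theorem lieMap_bracket_of_inverse {φ ψ : G →* G} (hφ : ContMDiff (𝓡 n) (𝓡 n) ∞ φ)
    (hψ : ContMDiff (𝓡 n) (𝓡 n) ∞ ψ) (h1 : ∀ g, φ (ψ g) = g) (h2 : ∀ g, ψ (φ g) = g)
    (v w : GroupLieAlgebra (𝓡 n) G) : lieMap φ ⁅v, w⁆ = ⁅lieMap φ v, lieMap φ w⁆ := by
  have hd : ∀ g, MDifferentiableAt (𝓡 n) (𝓡 n) φ g := fun g => (hφ g).mdifferentiableAt (by simp)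
  have hd' : ∀ g, MDifferentiableAt (𝓡 n) (𝓡 n) ψ g :=
    fun g => (hψ g).mdifferentiableAt (by simp)
  have c1 : ∀ g, (mfderiv (𝓡 n) (𝓡 n) ψ (φ g)).comp (mfderiv (𝓡 n) (𝓡 n) φ g) =
      ContinuousLinearMap.id ℝ (EuclideanSpace ℝ (Fin n)) := fun g => by
    have e : (ψ : G → G) ∘ φ = id := by ext x; exact h2 x
    have h := mfderiv_comp (I := 𝓡 n) (I' := 𝓡 n) (I'' := 𝓡 n) g (hd' (φ g)) (hd g)
    rw [e, mfderiv_id] at h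
    exact h.symm
  have c2 : ∀ g, (mfderiv (𝓡 n) (𝓡 n) φ g).comp (mfderiv (𝓡 n) (𝓡 n) ψ (φ g)) =
      ContinuousLinearMap.id ℝ (EuclideanSpace ℝ (Fin n)) := fun g => by
    have e : (φ : G → G) ∘ ψ = id := by ext x; exact h1 x
    have h := mfderiv_comp (I := 𝓡 n) (I' := 𝓡 n) (I'' := 𝓡 n) (φ g) (hd (ψ (φ g))) (hd' (φ g))
    rw [e, mfderiv_id, h2] at h
    exact h.symm
  have inv : ∀ g, (mfderiv (𝓡 n) (𝓡 n) φ g).inverse = mfderiv (𝓡 n) (𝓡 n) ψ (φ g) :=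
    fun g => ContinuousLinearMap.inverse_eq (c2 g) (c1 g)
  have pull : ∀ v : GroupLieAlgebra (𝓡 n) G,
      mpullback (𝓡 n) (𝓡 n) φ (mulInvariantVectorField (lieMap φ v)) =
        mulInvariantVectorField v := fun v => by
    ext g
    rw [mpullback_apply, ← mfderiv_mulInvariantVectorField φ hφ, inv]
    exact congrArg (fun T : EuclideanSpace ℝ (Fin n) →L[ℝ] EuclideanSpace ℝ (Fin n) =>
      T (mulInvariantVectorField v g)) (c1 g)
  have h := mpullback_mlieBracket (I := 𝓡 n) (I' := 𝓡 n) (n := ∞) (f := φ) (x₀ := (1 : G))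
    (V := mulInvariantVectorField (lieMap φ v)) (W := mulInvariantVectorField (lieMap φ w))
    (mdifferentiableAt_mulInvariantVectorField _) (mdifferentiableAt_mulInvariantVectorField _)
    (hφ 1) (by
      rw [minSmoothness_of_isRCLikeNormedField]
      exact ENat.LEInfty.out)
  rw [pull, pull, mpullback_apply, inv] at h
  have h3 : φ 1 = 1 := map_one φ
  have h4 := congrArg (fun x : EuclideanSpace ℝ (Fin n) =>
    (mfderiv (𝓡 n) (𝓡 n) φ 1 : EuclideanSpace ℝ (Fin n) →L[ℝ] EuclideanSpace ℝ (Fin n)) x) h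
  have h5 := congrArg (fun T : EuclideanSpace ℝ (Fin n) →L[ℝ] EuclideanSpace ℝ (Fin n) =>
    T (mlieBracket (𝓡 n) (mulInvariantVectorField (lieMap φ v))
      (mulInvariantVectorField (lieMap φ w)) (φ 1))) (c2 1)
  have h6 := h4.symm.trans h5
  rw [h3] at h6
  exact h6

theorem Ad_bracket (g : G) (X Y : GroupLieAlgebra (𝓡 n) G) :
    Ad g ⁅X, Y⁆ = ⁅Ad g X, Ad g Y⁆ :=
  lieMap_bracket_of_inverse (ψ := (MulAut.conj g⁻¹).toMonoidHom) (contMDiff_conj g)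
    (contMDiff_conj g⁻¹) (fun x => by simp [mul_assoc]) (fun x => by simp [mul_assoc]) X Y

theorem hasDerivAt_Ad_of_eq_one {c : ℝ → G} {s : ℝ} {X : GroupLieAlgebra (𝓡 n) G}
    (hc : HasMFDerivAt 𝓘(ℝ, ℝ) (𝓡 n) c s
      ((1 : ℝ →L[ℝ] ℝ).smulRight (X : EuclideanSpace ℝ (Fin n)))) (hs : c s = 1)
    (Y : GroupLieAlgebra (𝓡 n) G) :
    HasDerivAt (F := EuclideanSpace ℝ (Fin n)) (fun t => Ad (c t) Y)
      (⁅X, Y⁆ : GroupLieAlgebra (𝓡 n) G) s := by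
  obtain ⟨T, hT, h⟩ := hasFDerivAt_Ad_chart (G := G) Y
  have h1 : HasMFDerivAt (𝓡 n) 𝓘(ℝ, EuclideanSpace ℝ (Fin n)) (extChartAt (𝓡 n) (1 : G)) (c s)
      (ContinuousLinearMap.id ℝ (EuclideanSpace ℝ (Fin n))) := by
    rw [hs]
    have h0 := (mdifferentiableAt_extChartAt (I := 𝓡 n)
      (mem_chart_source (EuclideanSpace ℝ (Fin n)) (1 : G))).hasMFDerivAt
    rw [mfderiv_extChartAt_self] at h0
    exact h0
  have h2 : HasFDerivAt (fun t => extChartAt (𝓡 n) (1 : G) (c t))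
      ((ContinuousLinearMap.id ℝ (EuclideanSpace ℝ (Fin n))).comp
        ((1 : ℝ →L[ℝ] ℝ).smulRight (X : EuclideanSpace ℝ (Fin n)))) s :=
    hasMFDerivAt_iff_hasFDerivAt.1 (HasMFDerivAt.comp s h1 hc)
  have h3 : HasFDerivAt (F := EuclideanSpace ℝ (Fin n))
      (fun a => Ad ((extChartAt (𝓡 n) (1 : G)).symm a) Y) T (extChartAt (𝓡 n) (1 : G) (c s)) := by
    rw [hs]; exact hT
  have h4 := (HasFDerivAt.comp (f := fun t => extChartAt (𝓡 n) (1 : G) (c t)) s h3 h2).hasDerivAt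
  have h5 : ∀ᶠ t in 𝓝 s, c t ∈ (extChartAt (𝓡 n) (1 : G)).source := by
    refine hc.continuousAt.eventually_mem ?_
    rw [hs]
    exact extChartAt_source_mem_nhds (I := 𝓡 n) (1 : G)
  have h6 := HasDerivAt.congr_of_eventuallyEq (F := EuclideanSpace ℝ (Fin n))
    (f₁ := fun t => Ad (c t) Y) h4 (h5.mono fun t ht => by
      change _ = (Ad ((extChartAt (𝓡 n) (1 : G)).symm (extChartAt (𝓡 n) (1 : G) (c t))) Y :
        EuclideanSpace ℝ (Fin n))
      rw [(extChartAt (𝓡 n) (1 : G)).left_inv ht])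
  rw [← h X]
  convert! h6 using 1
  exact congrArg T (one_smul ℝ (X : EuclideanSpace ℝ (Fin n))).symm

/-- Since `Ad (γ s) = Ad (γ t) ∘ Ad ((γ t)⁻¹ γ s)`, left translation reduces the claim to a curve
passing through the identity with velocity `X`. -/
theorem hasDerivAt_Ad {γ : ℝ → G} {t : ℝ} {X : GroupLieAlgebra (𝓡 n) G}
    (hγ : HasMFDerivAt 𝓘(ℝ, ℝ) (𝓡 n) γ t
      ((1 : ℝ →L[ℝ] ℝ).smulRight (mulInvariantVectorField X (γ t))))
    (Y : GroupLieAlgebra (𝓡 n) G) :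
    HasDerivAt (F := EuclideanSpace ℝ (Fin n)) (fun s => Ad (γ s) Y)
      (Ad (γ t) ⁅X, Y⁆ : GroupLieAlgebra (𝓡 n) G) t := by
  have h2 := hasMFDerivAt_comp_curve (mdifferentiableAt_mul_left (n := n) (γ t)⁻¹ (γ t)) hγ
  have h3 : (mfderiv (𝓡 n) (𝓡 n) (fun b : G => (γ t)⁻¹ * b) (γ t))
      (mulInvariantVectorField X (γ t)) = (X : EuclideanSpace ℝ (Fin n)) := by
    have h0 := mfderiv_comp (I := 𝓡 n) (I' := 𝓡 n) (I'' := 𝓡 n) (1 : G)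
      (mdifferentiableAt_mul_left (γ t)⁻¹ (γ t * 1)) (mdifferentiableAt_mul_left (γ t) 1)
    have e : (fun b : G => (γ t)⁻¹ * b) ∘ (fun b : G => γ t * b) = id := by ext b; simp
    rw [e, mfderiv_id, mul_one] at h0
    exact (congrArg (fun T : EuclideanSpace ℝ (Fin n) →L[ℝ] EuclideanSpace ℝ (Fin n) => T X)
      h0).symm
  have h4 : HasMFDerivAt 𝓘(ℝ, ℝ) (𝓡 n) (fun s => (γ t)⁻¹ * γ s) t
      ((1 : ℝ →L[ℝ] ℝ).smulRight (X : EuclideanSpace ℝ (Fin n))) := by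
    rw [← h3]
    exact h2
  have h5 := hasDerivAt_Ad_of_eq_one h4 (by simp) Y
  let A : EuclideanSpace ℝ (Fin n) →L[ℝ] EuclideanSpace ℝ (Fin n) := Ad (γ t)
  have h6 := A.hasFDerivAt.comp_hasDerivAt t h5
  refine h6.congr_of_eventuallyEq (Filter.Eventually.of_forall fun s => ?_)
  change (Ad (γ s) Y : EuclideanSpace ℝ (Fin n)) = Ad (γ t) (Ad ((γ t)⁻¹ * γ s) Y)
  rw [← Ad_mul, mul_inv_cancel_left]

theorem contMDiffAt_one_mulInvariantVectorField (X : GroupLieAlgebra (𝓡 n) G) (g : G) :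
    ContMDiffAt (𝓡 n) (𝓡 n).tangent 1
      (fun x : G => (⟨x, mulInvariantVectorField X x⟩ : TangentBundle (𝓡 n) G)) g :=
  (contMDiffAt_mulInvariantVectorField X).of_le (by
    rw [minSmoothness_of_isRCLikeNormedField]
    norm_num)

/-- A local integral curve replaces the one-parameter subgroup: the conditions on `h₂` are local,
and the group law along the curve plays no role. -/
theorem exists_isMIntegralCurveAt_mulInvariantVectorField (X : GroupLieAlgebra (𝓡 n) G) :
    ∃ γ : ℝ → G, γ 0 = 1 ∧ IsMIntegralCurveAt γ (mulInvariantVectorField X) 0 :=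
  exists_isMIntegralCurveAt_of_contMDiffAt_boundaryless 0
    (contMDiffAt_one_mulInvariantVectorField X 1)

theorem eq_of_hasDerivAt_zero {F : Type*} [NormedAddCommGroup F] [NormedSpace ℝ F] {f : ℝ → F}
    {ε : ℝ} (hf : ∀ t ∈ Metric.ball (0 : ℝ) ε, HasDerivAt f 0 t) {t : ℝ}
    (ht : t ∈ Metric.ball (0 : ℝ) ε) : f t = f 0 := by
  have h0 : (0 : ℝ) ∈ Metric.ball (0 : ℝ) ε :=
    Metric.mem_ball_self (Metric.pos_of_mem_ball ht)
  have h := (convex_ball (0 : ℝ) ε).norm_image_sub_le_of_norm_hasDerivWithin_le (C := 0)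
    (fun x hx => (hf x hx).hasDerivWithinAt) (by simp) h0 ht
  rw [zero_mul] at h
  exact sub_eq_zero.1 (norm_le_zero_iff.1 h)

end Adjoint

/-! ### From the isotropy algebra to the isotropy group. -/

namespace SmoothInvolution

variable {n : ℕ} {G : Type*} [TopologicalSpace G] [ChartedSpace (EuclideanSpace ℝ (Fin n)) G]
  [Group G] [LieGroup (𝓡 n) ∞ G] (σ : SmoothInvolution n G)

/-- As `σ X = X`, the curve `σ ∘ γ` is an integral curve of the same field with the same initial
point, so uniqueness gives `σ ∘ γ = γ` near `0`. -/
theorem eventually_mem_H {X : GroupLieAlgebra (𝓡 n) G} (hX : X ∈ σ.𝓗) {γ : ℝ → G}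
    (h0 : γ 0 = 1) (hγ : IsMIntegralCurveAt γ (mulInvariantVectorField X) 0) :
    ∀ᶠ t in 𝓝 0, γ t ∈ σ.H := by
  have hX' : lieMap σ.hom X = X := hX
  have h1 : IsMIntegralCurveAt (fun t => σ.hom (γ t)) (mulInvariantVectorField X) 0 := by
    filter_upwards [hγ] with t ht
    have h2 := hasMFDerivAt_comp_curve ((σ.smooth (γ t)).mdifferentiableAt (by simp)) ht
    have h3 := mfderiv_mulInvariantVectorField σ.hom σ.smooth X (γ t)
    rw [hX'] at h3
    rw [← h3]
    exact h2
  exact isMIntegralCurveAt_eventuallyEq_of_contMDiffAt_boundaryless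
    (contMDiffAt_one_mulInvariantVectorField X _) h1 hγ (by simp [h0])

theorem coe_AdH (h : σ.H) (Y : σ.𝓗) :
    (σ.AdH h Y : GroupLieAlgebra (𝓡 n) G) = Ad (h : G) (Y : GroupLieAlgebra (𝓡 n) G) := rfl

/-- First `Ad (γ s) X = X`, since its derivative is `Ad (γ s) [X, X] = 0`. Then `μ (Ad (γ s) Y)` has
derivative `μ [Ad (γ s) X, Ad (γ s) Y] = μ [X, Ad (γ s) Y] = 0`, so it is constant. -/
theorem eventually_mem_isotropyGroup (μ : Module.Dual ℝ σ.𝓗) {X : σ.𝓗} (hX : X ∈ σ.𝓗μ μ)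
    {γ : ℝ → G} (h0 : γ 0 = 1)
    (hγ : IsMIntegralCurveAt γ (mulInvariantVectorField (X : GroupLieAlgebra (𝓡 n) G)) 0) :
    ∀ᶠ t in 𝓝 0, γ t ∈ σ.isotropyGroup μ := by
  obtain ⟨ε, hε, hball⟩ := Metric.eventually_nhds_iff_ball.1
    (hγ.and (σ.eventually_mem_H X.2 h0 hγ))
  refine Metric.eventually_nhds_iff_ball.2 ⟨ε, hε, fun t ht => ?_⟩
  have hfix : ∀ s ∈ Metric.ball (0 : ℝ) ε,
      Ad (γ s) (X : GroupLieAlgebra (𝓡 n) G) = X := fun s hs => by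
    have h1 := eq_of_hasDerivAt_zero (F := EuclideanSpace ℝ (Fin n))
      (f := fun s => Ad (γ s) (X : GroupLieAlgebra (𝓡 n) G)) (ε := ε) (fun r hr => by
        have h2 := hasDerivAt_Ad (hball r hr).1 (X : GroupLieAlgebra (𝓡 n) G)
        rw [lie_self, map_zero] at h2
        exact h2) hs
    refine h1.trans ?_
    rw [h0, Ad_one]
  have hX' : ∀ Y : σ.𝓗, μ ⁅X, Y⁆ = 0 := fun Y => LinearMap.congr_fun (show σ.χ μ X = 0 from hX) Y
  -- Extending `μ` to the whole Lie algebra makes `s ↦ ν (Ad (γ s) Y)` meaningful for every `s`,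
  -- without a proof that `γ s ∈ H`.
  obtain ⟨ν, hν⟩ := LinearMap.exists_extend (p := σ.𝓗.toSubmodule) μ
  let ν' : EuclideanSpace ℝ (Fin n) →ₗ[ℝ] ℝ := ν
  have hinv : ∀ Y : σ.𝓗, μ (σ.AdH ⟨γ t, (hball t ht).2⟩ Y) = μ Y := fun Y => by
    have h1 := eq_of_hasDerivAt_zero (f := fun s => ν'.toContinuousLinearMap
      (Ad (γ s) (Y : GroupLieAlgebra (𝓡 n) G) : EuclideanSpace ℝ (Fin n))) (ε := ε)
      (fun r hr => by
        have h2 := ν'.toContinuousLinearMap.hasFDerivAt.comp_hasDerivAt r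
          (hasDerivAt_Ad (hball r hr).1 (Y : GroupLieAlgebra (𝓡 n) G))
        rw [Ad_bracket, hfix r hr] at h2
        have h3 : ν ⁅(X : GroupLieAlgebra (𝓡 n) G),
            Ad (γ r) (Y : GroupLieAlgebra (𝓡 n) G)⁆ = 0 :=
          (LinearMap.congr_fun hν ⁅X, σ.AdH ⟨γ r, (hball r hr).2⟩ Y⁆).trans (hX' _)
        have h4 : ν'.toContinuousLinearMap (⁅(X : GroupLieAlgebra (𝓡 n) G),
            Ad (γ r) (Y : GroupLieAlgebra (𝓡 n) G)⁆ : GroupLieAlgebra (𝓡 n) G) = 0 := h3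
        rw [h4] at h2
        exact h2) ht
    have h5 : ν (Ad (γ t) (Y : GroupLieAlgebra (𝓡 n) G)) = ν (Y : GroupLieAlgebra (𝓡 n) G) := by
      refine (show _ = ν (Ad (γ 0) (Y : GroupLieAlgebra (𝓡 n) G)) from h1).trans ?_
      rw [h0, Ad_one]
    exact (LinearMap.congr_fun hν _).symm.trans (h5.trans (LinearMap.congr_fun hν Y))
  refine ⟨⟨γ t, (hball t ht).2⟩, rfl, fun Y => ?_⟩
  -- The isotropy group is defined through `h⁻¹`; invariance under `h`, applied to `Ad h⁻¹ Y`, gives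
  -- it.
  rw [← hinv]
  congr 1
  apply Subtype.ext
  rw [coe_AdH, coe_AdH, ← Ad_mul]
  simp [Ad_one]

end SmoothInvolution

/-! ### The derivative of the right factor, and inversion of `μ̂`. -/

namespace SmoothInvolution

variable {n : ℕ} {G : Type*} [TopologicalSpace G] [ChartedSpace (EuclideanSpace ℝ (Fin n)) G]
  [Group G] [LieGroup (𝓡 n) ∞ G] {σ : SmoothInvolution n G}

theorem IsRightFactor.apply_self {𝓐 : Submodule ℝ (GroupLieAlgebra (𝓡 n) G)}
    {μ : Module.Dual ℝ σ.𝓗} {q : 𝓐} {Q : G} {h₂ : G → G} (h : σ.IsRightFactor 𝓐 μ q Q h₂)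
    (hQ : IsExp (q : GroupLieAlgebra (𝓡 n) G) Q) : h₂ Q = 1 := by
  have h1 := h.onLevel.self_of_nhds ⟨1, rfl, fun X => by
    congr 1
    apply Subtype.ext
    rw [coe_AdH]
    simp [Ad_one]⟩ q.2 σ.H.one_mem Q hQ
  simpa using h1

theorem IsRightFactor.mdifferentiableAt {𝓐 : Submodule ℝ (GroupLieAlgebra (𝓡 n) G)}
    {μ : Module.Dual ℝ σ.𝓗} {q : 𝓐} {Q : G} {h₂ : G → G} (h : σ.IsRightFactor 𝓐 μ q Q h₂) :
    MDifferentiableAt (𝓡 n) (𝓡 n) (fun x => h₂ (Q * x)) 1 := by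
  have h1 : MDifferentiableAt (𝓡 n) (𝓡 n) h₂ (Q * 1) := by
    rw [mul_one]
    exact h.smooth.mdifferentiableAt (by simp)
  exact h1.comp 1 (mdifferentiableAt_mul_left Q 1)

/-- Near `Q` the values of `h₂` are fixed by `σ`; differentiate `σ ∘ h₂ = h₂` at `Q`, where `h₂ Q =
1`. -/
theorem IsRightFactor.nabla_mem {𝓐 : Submodule ℝ (GroupLieAlgebra (𝓡 n) G)}
    {μ : Module.Dual ℝ σ.𝓗} {q : 𝓐} {Q : G} {h₂ : G → G} (h : σ.IsRightFactor 𝓐 μ q Q h₂)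
    (hQ : IsExp (q : GroupLieAlgebra (𝓡 n) G) Q) (Z : GroupLieAlgebra (𝓡 n) G) :
    nabla h₂ Q Z ∈ σ.𝓗 := by
  have h1 : (fun x => σ.hom (h₂ (Q * x))) =ᶠ[𝓝 1] fun x => h₂ (Q * x) := by
    have t : Filter.Tendsto (fun x : G => Q * x) (𝓝 1) (𝓝 Q) := by
      have := (mdifferentiableAt_mul_left (n := n) Q 1).continuousAt.tendsto
      rwa [mul_one] at this
    exact (t.eventually h.decomp).mono fun x hx => hx.1
  have h2 : HasMFDerivAt (𝓡 n) (𝓡 n) σ.hom (h₂ (Q * 1)) (lieMap σ.hom) := by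
    rw [mul_one, h.apply_self hQ]
    exact ((σ.smooth 1).mdifferentiableAt (by simp)).hasMFDerivAt
  have h3 := (HasMFDerivAt.comp (1 : G) h2 h.mdifferentiableAt.hasMFDerivAt).mfderiv
  have h4 := h1.mfderiv_eq (I := 𝓡 n) (I' := 𝓡 n)
  have h5 := h4.symm.trans h3
  exact (congrArg (fun T : EuclideanSpace ℝ (Fin n) →L[ℝ] EuclideanSpace ℝ (Fin n) => T Z) h5).symm

/-- `D_Q` vanishes on the isotropy algebra, since `h₂ = 1` on `H_μ Q` near `Q`. -/
theorem IsRightFactor.DQ_eq_zero {𝓐 : Submodule ℝ (GroupLieAlgebra (𝓡 n) G)}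
    {μ : Module.Dual ℝ σ.𝓗} {q : 𝓐} {Q : G} {h₂ : G → G} (h : σ.IsRightFactor 𝓐 μ q Q h₂)
    (hQ : IsExp (q : GroupLieAlgebra (𝓡 n) G) Q) {X : σ.𝓗} (hX : X ∈ σ.𝓗μ μ) :
    σ.DQ h₂ Q X = 0 := by
  obtain ⟨γ, h0, hγ⟩ :=
    exists_isMIntegralCurveAt_mulInvariantVectorField (X : GroupLieAlgebra (𝓡 n) G)
  have hd : HasMFDerivAt 𝓘(ℝ, ℝ) (𝓡 n) γ 0
      ((1 : ℝ →L[ℝ] ℝ).smulRight (X.1 : EuclideanSpace ℝ (Fin n))) := by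
    have h1 := hγ.hasMFDerivAt
    have h2 : mulInvariantVectorField (X : GroupLieAlgebra (𝓡 n) G) (1 : G) = X := by
      have e : (fun x : G => 1 * x) = id := by ext; simp
      unfold mulInvariantVectorField
      rw [e]
      erw [mfderiv_id]
      rfl
    rw [h0] at h1
    erw [h2] at h1
    exact h1
  have hone : ∀ᶠ t in 𝓝 0, h₂ (γ t * Q) = 1 := by
    have t1 : Filter.Tendsto (fun t => (γ t, (q : GroupLieAlgebra (𝓡 n) G), (1 : G))) (𝓝 0)
        (𝓝 (1, (q : GroupLieAlgebra (𝓡 n) G), 1)) := by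
      have := hd.continuousAt.tendsto
      rw [h0] at this
      exact this.prodMk_nhds tendsto_const_nhds
    filter_upwards [t1.eventually h.onLevel, σ.eventually_mem_isotropyGroup μ hX h0 hγ]
      with t ht1 ht2
    simpa using ht1 ht2 q.2 σ.H.one_mem Q hQ
  -- The curve `Q⁻¹ γ(t) Q` has velocity `Ad Q⁻¹ X`, and `Q` times it is `γ(t) Q`; so `D_Q X` is the
  -- velocity of `h₂ (γ(t) Q)`, which is constantly `1`.
  have hc : HasMFDerivAt 𝓘(ℝ, ℝ) (𝓡 n) (fun t => MulAut.conj Q⁻¹ (γ t)) 0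
      ((1 : ℝ →L[ℝ] ℝ).smulRight
        (Ad Q⁻¹ (X : GroupLieAlgebra (𝓡 n) G) : EuclideanSpace ℝ (Fin n))) := by
    have h1 := hasMFDerivAt_comp_curve (f := (MulAut.conj Q⁻¹).toMonoidHom)
      (((contMDiff_conj Q⁻¹) (γ 0)).mdifferentiableAt (by simp)) hd
    rw [h0] at h1
    exact h1
  have hc0 : MulAut.conj Q⁻¹ (γ 0) = 1 := by simp [h0]
  have hF := hasMFDerivAt_comp_curve (f := fun x => h₂ (Q * x))
    (by rw [hc0]; exact h.mdifferentiableAt) hc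
  rw [hc0] at hF
  have hconst : HasMFDerivAt 𝓘(ℝ, ℝ) (𝓡 n) (fun t => h₂ (Q * MulAut.conj Q⁻¹ (γ t))) 0
      (0 : ℝ →L[ℝ] EuclideanSpace ℝ (Fin n)) := by
    refine HasMFDerivAt.congr_of_eventuallyEq (hasMFDerivAt_const (1 : G) (0 : ℝ)) ?_
    filter_upwards [hone] with t ht
    simpa [mul_assoc] using ht
  have h6 := hasMFDerivAt_unique hF hconst
  have h7 := congrArg (fun T : ℝ →L[ℝ] EuclideanSpace ℝ (Fin n) => T 1) h6
  exact (one_smul ℝ _).symm.trans h7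

/-- A maximal isotropic subspace is its own orthogonal. -/
theorem IsMaxIsotropic.mem_of_orthogonal {μ : Module.Dual ℝ σ.𝓗} {W : Submodule ℝ σ.𝓗}
    (h : σ.IsMaxIsotropic μ W) {v : σ.𝓗} (hv : ∀ X ∈ W, σ.χ μ X v = 0) : v ∈ σ.𝓗μ μ ⊔ W := by
  have skew : ∀ X Y, σ.χ μ X Y = -σ.χ μ Y X := fun X Y => by
    change μ ⁅X, Y⁆ = -μ ⁅Y, X⁆
    rw [← lie_skew, map_neg]
  have hv' : ∀ X ∈ σ.𝓗μ μ ⊔ W, σ.χ μ X v = 0 := fun X hX => by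
    obtain ⟨a, ha, b, hb, rfl⟩ := Submodule.mem_sup.1 hX
    have ha' : σ.χ μ a = 0 := ha
    rw [map_add, LinearMap.add_apply, hv b hb, ha', LinearMap.zero_apply, add_zero]
  have hvv : σ.χ μ v v = 0 := by
    change μ ⁅v, v⁆ = 0
    rw [lie_self, map_zero]
  -- Adjoining `v` preserves isotropy because `χ (v, v) = 0`; maximality then forces `v` into the
  -- subspace.
  have h1 : ∀ X ∈ (σ.𝓗μ μ ⊔ W) ⊔ ℝ ∙ v, ∀ Y ∈ (σ.𝓗μ μ ⊔ W) ⊔ ℝ ∙ v, σ.χ μ X Y = 0 := by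
    intro X hX Y hY
    obtain ⟨a, ha, _, hs, rfl⟩ := Submodule.mem_sup.1 hX
    obtain ⟨s, rfl⟩ := Submodule.mem_span_singleton.1 hs
    obtain ⟨b, hb, _, ht, rfl⟩ := Submodule.mem_sup.1 hY
    obtain ⟨t, rfl⟩ := Submodule.mem_span_singleton.1 ht
    simp only [map_add, map_smul, LinearMap.add_apply, LinearMap.smul_apply, h.prop a ha b hb,
      hv' a ha, hvv, skew v b, hv' b hb]
    simp
  exact h.le_of_ge h1 le_sup_left (Submodule.mem_sup_right (Submodule.mem_span_singleton_self v))

theorem muHat_mkQ (μ : Module.Dual ℝ σ.𝓗) (V X : σ.𝓗) :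
    σ.muHat μ ((σ.𝓗μ μ).mkQ V) X = σ.χ μ X V := rfl

theorem muHat_injective (μ : Module.Dual ℝ σ.𝓗) : Function.Injective (σ.muHat μ) := by
  rw [← LinearMap.ker_eq_bot, LinearMap.ker_eq_bot']
  intro v hv
  obtain ⟨V, rfl⟩ := (σ.𝓗μ μ).mkQ_surjective v
  rw [Submodule.mkQ_apply, Submodule.Quotient.mk_eq_zero]
  change σ.χ μ V = 0
  ext X
  have h := LinearMap.congr_fun hv X
  rw [muHat_mkQ] at h
  change μ ⁅V, X⁆ = 0
  rw [← lie_skew, map_neg, neg_eq_zero]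
  exact h

theorem finiteDimensional_𝓗 (σ : SmoothInvolution n G) : FiniteDimensional ℝ σ.𝓗 := by
  have : FiniteDimensional ℝ (GroupLieAlgebra (𝓡 n) G) :=
    inferInstanceAs (FiniteDimensional ℝ (EuclideanSpace ℝ (Fin n)))
  exact inferInstanceAs (FiniteDimensional ℝ σ.𝓗.toSubmodule)

/-- The range of `μ̂` is the annihilator of `𝓗_μ`. -/
theorem range_muHat (μ : Module.Dual ℝ σ.𝓗) :
    LinearMap.range (σ.muHat μ) = (σ.𝓗μ μ).dualAnnihilator := by
  have := σ.finiteDimensional_𝓗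
  refine Submodule.eq_of_le_of_finrank_eq ?_ ?_
  · rintro _ ⟨v, rfl⟩
    obtain ⟨V, rfl⟩ := (σ.𝓗μ μ).mkQ_surjective v
    rw [Submodule.mem_dualAnnihilator]
    intro X hX
    rw [muHat_mkQ, show σ.χ μ X = 0 from hX, LinearMap.zero_apply]
  -- Both sides have dimension `dim 𝓗 - dim 𝓗_μ`.
  · rw [LinearMap.finrank_range_of_inj (muHat_injective μ)]
    have h1 := Subspace.finrank_add_finrank_dualAnnihilator_eq (σ.𝓗μ μ)
    have h2 := (σ.𝓗μ μ).finrank_quotient_add_finrank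
    omega

theorem existsUnique_linear_correction (μ : Module.Dual ℝ σ.𝓗) {M : Type*} [AddCommGroup M]
    [Module ℝ M] (l : M →ₗ[ℝ] Module.Dual ℝ σ.𝓗) (hl : ∀ Z, ∀ X ∈ σ.𝓗μ μ, l Z X = 0) :
    ∃ V : M →ₗ[ℝ] σ.𝓗 ⧸ σ.𝓗μ μ, ∀ Z v, σ.muHat μ v = l Z ↔ v = V Z := by
  let e := LinearEquiv.ofInjective (σ.muHat μ) (muHat_injective μ)
  have hr : ∀ Z, l Z ∈ LinearMap.range (σ.muHat μ) := fun Z => by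
    rw [range_muHat, Submodule.mem_dualAnnihilator]
    exact hl Z
  have hV : ∀ Z, σ.muHat μ (e.symm (l.codRestrict _ hr Z)) = l Z := fun Z =>
    congrArg Subtype.val (e.apply_symm_apply (l.codRestrict _ hr Z))
  refine ⟨e.symm.toLinearMap ∘ₗ l.codRestrict _ hr, fun Z v => ⟨fun h => ?_, ?_⟩⟩
  · exact muHat_injective μ (h.trans (hV Z).symm)
  · rintro rfl
    exact hV Z

end SmoothInvolution
end

end Calogero

/-! ### The correction vector and the `R`-matrix. -/

theorem mainTheorem2 {n : ℕ} {G : Type*} [TopologicalSpace G]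
    [ChartedSpace (EuclideanSpace ℝ (Fin n)) G] [Group G] [LieGroup (𝓡 n) ∞ G]
    (σ : Calogero.SmoothInvolution n G) (hσ : σ.IsCartan)
    (𝓐 : Submodule ℝ (GroupLieAlgebra (𝓡 n) G)) (hA : σ.IsCartanSubspace 𝓐)
    (𝓑 𝓒 : Submodule ℝ σ.𝓗) (hB : σ.IsCommutativeExtension 𝓐 𝓑)
    (μ : Module.Dual ℝ σ.𝓗) (hsplit : σ.IsLagrangianSplitting μ 𝓑 𝓒)
    (q : 𝓐) (Q : G) (L : Module.Dual ℝ (GroupLieAlgebra (𝓡 n) G))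
    (hQL : σ.IsSectionPoint 𝓐 μ q Q L)
    (h₂ : G → G) (hh₂ : σ.IsRightFactor 𝓐 μ q Q h₂)
    (hC : ∀ X ∈ 𝓒, σ.DQ h₂ Q X = 0) :
    (∃ V : σ.𝓚 →ₗ[ℝ] σ.𝓗 ⧸ σ.𝓗μ μ,
      (∀ Z v, σ.IsCorrection μ h₂ Q L Z v ↔ v = V Z) ∧
      (∀ Z, V Z ∈ 𝓒.map (σ.𝓗μ μ).mkQ) ∧
      (∀ (Z : σ.𝓚) (W : σ.𝓗), (σ.𝓗μ μ).mkQ W = V Z → σ.DQ h₂ Q W = 0)) ∧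
    (∃ R : σ.𝓚 →ₗ[ℝ] σ.𝓗,
      (∀ R', σ.IsRMatrix μ h₂ Q L R' ↔ R' = R) ∧
      (∀ Z : σ.𝓚, (R Z : GroupLieAlgebra (𝓡 n) G) =
        Calogero.nabla h₂ Q (Z : GroupLieAlgebra (𝓡 n) G))) := by
  have hD : ∀ X ∈ σ.𝓗μ μ ⊔ 𝓒, σ.DQ h₂ Q X = 0 := fun X hX => by
    obtain ⟨a, ha, b, hb, rfl⟩ := Submodule.mem_sup.1 hX
    rw [map_add, hh₂.DQ_eq_zero hQL.exp ha, hC b hb, add_zero]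
  let l : σ.𝓚 →ₗ[ℝ] Module.Dual ℝ σ.𝓗 :=
    { toFun := fun Z => σ.lam h₂ Q L Z
      map_add' := fun Z W => by
        ext X
        simp [Calogero.SmoothInvolution.lam]
      map_smul' := fun c Z => by
        ext X
        simp [Calogero.SmoothInvolution.lam] }
  have hl : ∀ Z, ∀ X ∈ σ.𝓗μ μ ⊔ 𝓒, l Z X = 0 := fun Z X hX => by
    change L ⁅(Z : GroupLieAlgebra (𝓡 n) G), σ.DQ h₂ Q X⁆ = 0
    rw [hD X hX, lie_zero, map_zero]
  obtain ⟨V, hV⟩ := Calogero.SmoothInvolution.existsUnique_linear_correction μ l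
    fun Z X hX => hl Z X (Submodule.mem_sup_left hX)
  -- For `X ∈ 𝓒` one has `χ (X, W) = λ_Z (X) = 0`, so every representative `W` is orthogonal to `𝓒`.
  have hmem : ∀ (Z : σ.𝓚) (W : σ.𝓗), (σ.𝓗μ μ).mkQ W = V Z → W ∈ σ.𝓗μ μ ⊔ 𝓒 := fun Z W hW =>
    hsplit.maxIsotropic_right.mem_of_orthogonal fun X hX => by
      rw [← Calogero.SmoothInvolution.muHat_mkQ, (hV Z _).2 hW]
      exact hl Z X (Submodule.mem_sup_right hX)
  refine ⟨⟨V, hV, fun Z => ?_, fun Z W hW => hD W (hmem Z W hW)⟩, ?_⟩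
  · obtain ⟨W, hW⟩ := (σ.𝓗μ μ).mkQ_surjective (V Z)
    obtain ⟨a, ha, b, hb, rfl⟩ := Submodule.mem_sup.1 (hmem Z W hW)
    refine ⟨b, hb, ?_⟩
    rw [← hW, map_add, Submodule.mkQ_apply _ a, (Submodule.Quotient.mk_eq_zero _).2 ha, zero_add]
  · let R : σ.𝓚 →ₗ[ℝ] σ.𝓗 :=
      ((Calogero.nabla h₂ Q).toLinearMap.codRestrict σ.𝓗.toSubmodule
        (hh₂.nabla_mem hQL.exp)) ∘ₗ σ.𝓚.subtype
    have hR : ∀ Z : σ.𝓚, (R Z : GroupLieAlgebra (𝓡 n) G) =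
        Calogero.nabla h₂ Q (Z : GroupLieAlgebra (𝓡 n) G) := fun Z => rfl
    refine ⟨R, fun R' => ⟨fun h => ?_, ?_⟩, hR⟩
    -- Each `Z` has a correction vector, so the defining condition of an `R`-matrix is never vacuous
    -- and determines `R' Z`.
    · ext Z
      obtain ⟨W, hW⟩ := (σ.𝓗μ μ).mkQ_surjective (V Z)
      rw [h Z W ((hV Z _).2 hW), hD W (hmem Z W hW), smul_zero, add_zero, hR]
    · rintro rfl Z W hW
      rw [hD W (hmem Z W ((hV Z _).1 hW)), smul_zero, add_zero, hR]
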